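/- There is an absolute constant $C>0$ such that the following holds for all integers $\Delta\ge 3$ and $c\ge 0$ and every finite vertex set $V$. Consider any sequence of $T\ge 1$ edge insertions that starts from the empty graph on $V$, inserts a new edge in each step, and keeps the graph at all times a forest in which every vertex has degree at most $\Delta$. Let the algorithm Greedy maintain a proper edge coloring with a palette of $\Delta+c$ colors: whenever an edge $e$ is inserted into the current forest $F$, Greedy passes to a proper edge coloring of $F\cup\{e\}$ for which the number of edges of $F$ whose color changes is as small as possible; ties are broken by an arbitrary rule. The recourse of the insertion is this number of recolored edges of $F$ (coloring the new edge $e$ is not counted). Then, whatever the tie-breaking rule, the amortized recourse of Greedy, that is, the total recourse of the sequence divided by $T$, is at most $$\frac{C}{c+\sqrt{\Delta}}.$$ -/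

import Mathlib

namespace IncrementalForest

/-- An insertion sequence of the incremental model on the fixed vertex set `V`: the graph starts
empty, each update inserts one new edge (not a loop, not already present), and at every time the
current graph is a forest all of whose degrees are at most `Δ`. -/
structure InsertionSequence (V : Type*) (Δ : ℕ) where
  /-- the number of updates -/
  length : ℕ
  /-- the inserted edges, in their order of insertion -/
  edge : Fin length → Sym2 V
  not_isDiag : ∀ i, ¬ (edge i).IsDiag
  injective : Function.Injective edge
  isAcyclic : ∀ t ≤ length,
    (SimpleGraph.fromEdgeSet {e | ∃ i : Fin length, i.val < t ∧ edge i = e}).IsAcyclic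
  degree_le : ∀ t ≤ length, ∀ v : V,
    ((SimpleGraph.fromEdgeSet
      {e | ∃ i : Fin length, i.val < t ∧ edge i = e}).neighborSet v).encard ≤ Δ

/-- The forest after the first `t` insertions. -/
def InsertionSequence.forest {V : Type*} {Δ : ℕ} (σ : InsertionSequence V Δ) (t : ℕ) :
    SimpleGraph V :=
  SimpleGraph.fromEdgeSet {e | ∃ i : Fin σ.length, i.val < t ∧ σ.edge i = e}

/-- `col` restricts to a proper edge coloring of `G`: distinct edges of `G` with a common endpoint
get distinct colors. The values of `col` outside the edge set of `G` are irrelevant. -/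
def IsProperEdgeColoring {V : Type*} {κ : ℕ} (G : SimpleGraph V) (col : Sym2 V → Fin κ) : Prop :=
  ∀ u v w : V, G.Adj u v → G.Adj u w → v ≠ w → col s(u, v) ≠ col s(u, w)

/-- The edges of `G` whose color changes when `col` is replaced by `col'`. -/
def recoloredEdges {V : Type*} {κ : ℕ} (G : SimpleGraph V) (col col' : Sym2 V → Fin κ) :
    Set (Sym2 V) :=
  {e | e ∈ G.edgeSet ∧ col' e ≠ col e}

/-- The recourse of an update applied to the colored graph `(G, col)` that results in the coloring
`col'`: the number of previously present edges that are recolored. Coloring the newly inserted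
edge (which is not an edge of `G`) is not counted. -/
noncomputable def recourse {V : Type*} {κ : ℕ} (G : SimpleGraph V)
    (col col' : Sym2 V → Fin κ) : ℕ :=
  (recoloredEdges G col col').ncard

/-- `col'` is a possible outcome of the greedy algorithm when the graph `G`, colored by `col`, is
extended to `G'` by an insertion: `col'` is a proper coloring of `G'`, and no proper coloring of
`G'` recolors fewer edges of `G`. Ties are broken arbitrarily. -/
def IsGreedyUpdate {V : Type*} {κ : ℕ} (G G' : SimpleGraph V) (col col' : Sym2 V → Fin κ) : Prop :=
  IsProperEdgeColoring G' col' ∧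
    ∀ col'' : Sym2 V → Fin κ, IsProperEdgeColoring G' col'' →
      recourse G col col' ≤ recourse G col col''

/-- `col t` (for `t ≤ σ.length`) is the coloring after the first `t` insertions in some execution
of the greedy algorithm on `σ` with the palette `Fin κ`, under some tie-breaking rule. -/
def IsGreedyExecution {V : Type*} {Δ κ : ℕ} (σ : InsertionSequence V Δ)
    (col : ℕ → Sym2 V → Fin κ) : Prop :=
  ∀ t < σ.length, IsGreedyUpdate (σ.forest t) (σ.forest (t + 1)) (col t) (col (t + 1))

/-- The amortized recourse: the average recourse per update over the whole sequence. -/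
noncomputable def amortizedRecourse {V : Type*} {Δ κ : ℕ} (σ : InsertionSequence V Δ)
    (col : ℕ → Sym2 V → Fin κ) : ℝ :=
  (∑ t ∈ Finset.range σ.length, (recourse (σ.forest t) (col t) (col (t + 1)) : ℝ)) / σ.length

end IncrementalForest

namespace IncrementalForest

open SimpleGraph

/-! Write κ = Δ + c. Recourse at most two and recourse at least three are charged differently.

If the endpoints of the new edge share a free color, the recourse is zero. Hence a costly insertion,
one of positive recourse, has endpoint degrees summing to at least κ
(`le_degreeAt_add_of_recourse_pos`). Such insertions are rare (`card_mul_le`): choose distinct child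
endpoints for the edges of the final forest. A parent must keep room for the costly edges it has yet
to receive, so the child's degree makes up the difference; but all degrees sum to at most 2T. This
leaves O(T / (c + √Δ)) costly insertions.

For recourse r ≥ 3, one side of the new edge can be recolored along a Kempe chain. If no recoloring
of that side is cheaper than n, every shortcut through a third color costs at least n too, so the
side branches met along the chain are large in total. Summing over the chain, each side has on the
order of κ r² vertices (`exists_recolorable_sq_le`). So r = O(√(m/κ)), where m is the size of the
smaller side. This is paid for by the potential -∑ 1/√(max(4s, κ)), where s is the component size of
each vertex: it gains at least √m/8 in such a merge and at most 2T/√κ overall. The contribution is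
O(T/κ), and κ ≥ c + √Δ. -/

/-- The vertices of the branch of a forest that hangs from `w` through its neighbor `q`. -/
def branch {V : Type*} (G : SimpleGraph V) (w q : V) : Set V :=
  {p | ∃ P : G.Walk q p, P.IsPath ∧ w ∉ P.support}

/-- The edges of `G` that touch the branch of `q` seen from `w`; this includes the edge `wq`. -/
def branchEdges {V : Type*} (G : SimpleGraph V) (w q : V) : Set (Sym2 V) :=
  {e | e ∈ G.edgeSet ∧ ∃ p ∈ e, p ∈ branch G w q}

/-! ### Branches of a forest -/

section Branch

variable {V : Type*} {G : SimpleGraph V} {w q x y p p' : V}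

theorem mem_branch_self (h : G.Adj w q) : q ∈ branch G w q :=
  ⟨.nil, by simp, by simpa using h.ne⟩

theorem notMem_branch : w ∉ branch G w q := fun ⟨P, _, h⟩ => h P.end_mem_support

theorem eq_or_exists_mem_branch (hp : p ∈ branch G w q) :
    p = q ∨ ∃ x, G.Adj q x ∧ x ≠ w ∧ p ∈ branch G q x := by
  obtain ⟨P, hP, hw⟩ := hp
  cases P with
  | nil => exact .inl rfl
  | @cons _ x _ h P =>
    rw [Walk.cons_isPath_iff] at hP
    refine .inr ⟨x, h, ?_, P, hP.1, hP.2⟩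
    rintro rfl
    exact hw (by simp)

theorem branch_subset (hG : G.IsAcyclic) (hw : G.Adj w q) (hx : G.Adj q x) (hne : x ≠ w) :
    branch G q x ⊆ branch G w q := by
  classical
  rintro p ⟨P, hP, hq⟩
  refine ⟨.cons hx P, (Walk.cons_isPath_iff _ _).2 ⟨hP, hq⟩, ?_⟩
  rw [Walk.support_cons, List.mem_cons, not_or]
  refine ⟨hw.ne, fun hmem => hne ?_⟩
  have h1 : (Walk.cons hx (P.takeUntil w hmem)).IsPath :=
    (Walk.cons_isPath_iff _ _).2
      ⟨hP.takeUntil hmem, fun h => hq (P.support_takeUntil_subset_support hmem h)⟩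
  have := hG.eq_snd_of_adj_start h1 hw.symm (by simp)
  simpa using this.symm

theorem eq_of_mem_branch (hG : G.IsAcyclic) (hx : G.Adj q x) (hy : G.Adj q y)
    (hpx : p ∈ branch G q x) (hpy : p ∈ branch G q y) : x = y := by
  obtain ⟨P, hP, hq⟩ := hpx
  obtain ⟨Q, hQ, hq'⟩ := hpy
  have := (hG.subsingleton_path _ _).elim ⟨.cons hx P, (Walk.cons_isPath_iff _ _).2 ⟨hP, hq⟩⟩
    ⟨.cons hy Q, (Walk.cons_isPath_iff _ _).2 ⟨hQ, hq'⟩⟩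
  have h2 := congrArg (fun P : G.Path q p => P.1.snd) this
  simpa using h2

/-- A path from `q` to `p` avoiding `w` could be extended to `p'` unless `p' = w`; uniqueness of
paths then forces `p = q`. -/
theorem eq_and_eq_of_adj_of_notMem_branch (hG : G.IsAcyclic) (hw : G.Adj w q)
    (h : G.Adj p p') (hp : p ∈ branch G w q) (hp' : p' ∉ branch G w q) : p = q ∧ p' = w := by
  classical
  obtain ⟨P, hP, hwP⟩ := hp
  by_cases hmem : p' ∈ P.support
  · exact absurd ⟨P.takeUntil p' hmem, hP.takeUntil hmem,
      fun h => hwP (P.support_takeUntil_subset_support hmem h)⟩ hp'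
  · have hpw : p' = w := by
      by_contra hne
      refine hp' ⟨P.concat h, hP.concat hmem h, ?_⟩
      rw [Walk.support_concat]
      simp [hwP, Ne.symm hne]
    subst hpw
    have h1 := (hG.subsingleton_path _ _).elim ⟨.cons hw P, (Walk.cons_isPath_iff _ _).2 ⟨hP, hwP⟩⟩
      ⟨.cons h.symm .nil, by simp [h.ne']⟩
    have h2 := congrArg (fun P : G.Path p' p => P.1.snd) h1
    exact ⟨by simpa using h2.symm, rfl⟩

theorem eq_or_eq_of_mem_branchEdges (hG : G.IsAcyclic) (hw : G.Adj w q)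
    (he : s(p, p') ∈ branchEdges G w q) (hp : p ∉ branch G w q) : p = w ∧ p' = q := by
  obtain ⟨hadj, a, ha, hab⟩ := he
  rcases Sym2.mem_iff.1 ha with rfl | rfl
  · exact absurd hab hp
  · exact (eq_and_eq_of_adj_of_notMem_branch hG hw (G.mem_edgeSet.1 hadj).symm hab hp).symm

theorem mem_branchEdges_self (hw : G.Adj w q) : s(w, q) ∈ branchEdges G w q :=
  ⟨hw, q, by simp, mem_branch_self hw⟩

theorem notMem_branchEdges (hG : G.IsAcyclic) (hx : G.Adj q x) (hne : x ≠ w) :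
    s(w, q) ∉ branchEdges G q x := by
  intro h
  rw [Sym2.eq_swap] at h
  exact hne (eq_or_eq_of_mem_branchEdges hG hx h notMem_branch).2.symm

theorem branchEdges_subset (hG : G.IsAcyclic) (hw : G.Adj w q) (hx : G.Adj q x) (hne : x ≠ w) :
    branchEdges G q x ⊆ branchEdges G w q :=
  fun _ ⟨he, p, hp, hpb⟩ => ⟨he, p, hp, branch_subset hG hw hx hne hpb⟩

theorem eq_of_mem_branchEdges (hG : G.IsAcyclic) (hx : G.Adj q x) (hy : G.Adj q y) {e : Sym2 V}
    (hex : e ∈ branchEdges G q x) (hey : e ∈ branchEdges G q y) : x = y := by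
  obtain ⟨he, p, hp, hpx⟩ := id hex
  obtain ⟨p', rfl⟩ := hp
  by_cases hpy : p ∈ branch G q y
  · exact eq_of_mem_branch hG hx hy hpx hpy
  · obtain ⟨rfl, rfl⟩ := eq_or_eq_of_mem_branchEdges hG hy hey hpy
    exact absurd hpx notMem_branch

theorem branch_card_add_le [Finite V] (hG : G.IsAcyclic) (hw : G.Adj w q) (s : Finset V)
    (hs : ∀ x ∈ s, G.Adj q x ∧ x ≠ w) :
    1 + ∑ x ∈ s, (branch G q x).ncard ≤ (branch G w q).ncard := by
  have hfin : ∀ x : V, (branch G q x).Finite := fun x => Set.toFinite _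
  have h1 : (⋃ x ∈ (s : Set V), branch G q x).ncard = ∑ x ∈ s, (branch G q x).ncard := by
    rw [s.finite_toSet.ncard_biUnion (fun x _ => hfin x), finsum_mem_coe_finset]
    intro x hx y hy hxy
    exact Set.disjoint_left.2 fun p hpx hpy =>
      hxy (eq_of_mem_branch hG (hs x hx).1 (hs y hy).1 hpx hpy)
  have h2 : q ∉ ⋃ x ∈ (s : Set V), branch G q x := by
    simp only [Set.mem_iUnion, not_exists]
    exact fun x _ => notMem_branch
  rw [← h1, add_comm, ← Set.ncard_insert_of_notMem h2 (Set.toFinite _)]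
  refine Set.ncard_le_ncard (Set.insert_subset (mem_branch_self hw) ?_) (Set.toFinite _)
  exact Set.iUnion₂_subset fun x hx => branch_subset hG hw (hs x hx).1 (hs x hx).2

end Branch

/-! ### Recoloring a branch and its cost -/

/-- The edges of `G` at `p` have pairwise distinct colors. -/
def ProperAt {V : Type*} {κ : ℕ} (G : SimpleGraph V) (col : Sym2 V → Fin κ) (p : V) : Prop :=
  ∀ x y, G.Adj p x → G.Adj p y → x ≠ y → col s(p, x) ≠ col s(p, y)

/-- `col'` arises from `col` by changing the colors of the branch of `q` seen from `w`, gives the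
edge `wq` the color `γ` and is proper at the vertices of the branch. -/
structure IsBranchRecoloring {V : Type*} {κ : ℕ} (G : SimpleGraph V) (col : Sym2 V → Fin κ)
    (w q : V) (γ : Fin κ) (col' : Sym2 V → Fin κ) : Prop where
  eq_off : ∀ e ∉ branchEdges G w q, col' e = col e
  root : col' s(w, q) = γ
  proper : ∀ p ∈ branch G w q, ProperAt G col' p

/-- The branch of `q` seen from `w` can be recolored with at most `n` changes such that the edge
`wq` gets the color `γ`. -/
def Recolorable {V : Type*} {κ : ℕ} (G : SimpleGraph V) (col : Sym2 V → Fin κ) (w q : V)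
    (γ : Fin κ) (n : ℕ) : Prop :=
  ∃ col', IsBranchRecoloring G col w q γ col' ∧ recourse G col col' ≤ n

section Recolor

variable {V : Type*} {κ : ℕ} {G : SimpleGraph V} {col : Sym2 V → Fin κ} {w q x : V}
  {γ : Fin κ} {m n : ℕ}

theorem Recolorable.mono (h : Recolorable G col w q γ m) (hmn : m ≤ n) :
    Recolorable G col w q γ n :=
  let ⟨c, hc, hcm⟩ := h
  ⟨c, hc, hcm.trans hmn⟩

/-- The common source of all recolorings below. Permuting the colors at `q` keeps them distinct; the
branches of the children whose edges move are disjoint, so their recolorings can be glued and their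
costs add up. -/
theorem recolorable_perm [Finite V] (hG : G.IsAcyclic) (hw : G.Adj w q)
    (hcol : ∀ p ∈ branch G w q, ProperAt G col p) (σ : Equiv.Perm (Fin κ)) (s : Finset V)
    (n : V → ℕ) (hs : ∀ x ∈ s, G.Adj q x ∧ x ≠ w)
    (hrec : ∀ x ∈ s, Recolorable G col q x (σ (col s(q, x))) (n x))
    (hfix : ∀ x ∉ s, G.Adj q x → x ≠ w → σ (col s(q, x)) = col s(q, x)) :
    Recolorable G col w q (σ (col s(w, q))) (1 + ∑ x ∈ s, n x) := by
  classical
  have hrec' : ∀ x, ∃ g : Sym2 V → Fin κ, x ∈ s →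
      IsBranchRecoloring G col q x (σ (col s(q, x))) g ∧ recourse G col g ≤ n x := fun x => by
    by_cases hx : x ∈ s
    · obtain ⟨g, hg⟩ := hrec x hx
      exact ⟨g, fun _ => hg⟩
    · exact ⟨col, fun h => absurd h hx⟩
  choose g hg using hrec'
  let col' : Sym2 V → Fin κ := fun e =>
    if h : ∃ x ∈ s, e ∈ branchEdges G q x then g h.choose e
    else if e = s(w, q) then σ (col s(w, q)) else col e
  have hin : ∀ x ∈ s, ∀ e ∈ branchEdges G q x, col' e = g x e := by
    intro x hx e he
    have h : ∃ x ∈ s, e ∈ branchEdges G q x := ⟨x, hx, he⟩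
    have hxe : h.choose = x := eq_of_mem_branchEdges hG (hs _ h.choose_spec.1).1 (hs x hx).1
      h.choose_spec.2 he
    simp only [col', dif_pos h, hxe]
  have hroot : col' s(w, q) = σ (col s(w, q)) := by
    have h : ¬ ∃ x ∈ s, s(w, q) ∈ branchEdges G q x := fun ⟨x, hx, he⟩ =>
      notMem_branchEdges hG (hs x hx).1 (hs x hx).2 he
    simp only [col', dif_neg h, if_true]
  have hout : ∀ e, e ≠ s(w, q) → (∀ x ∈ s, e ∉ branchEdges G q x) → col' e = col e := by
    intro e he h
    have h : ¬ ∃ x ∈ s, e ∈ branchEdges G q x := fun ⟨x, hx, he⟩ => h x hx he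
    simp only [col', dif_neg h, if_neg he]
  have hchild : ∀ x, G.Adj q x → col' s(q, x) = σ (col s(q, x)) := by
    intro x hx
    by_cases hxw : x = w
    · subst hxw
      rw [Sym2.eq_swap, hroot]
    by_cases hxs : x ∈ s
    · rw [hin x hxs _ (mem_branchEdges_self hx), (hg x hxs).1.root]
    · rw [hfix x hxs hx hxw]
      refine hout _ (fun h => ?_) fun y hy hmem => hxs ?_
      · rw [Sym2.eq_swap, Sym2.congr_left] at h
        exact hxw h
      · rwa [eq_of_mem_branchEdges hG hx (hs y hy).1 (mem_branchEdges_self hx) hmem]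
  refine ⟨col', ⟨fun e he => ?_, hroot, fun p hp => ?_⟩, ?_⟩
  · refine hout e (fun h => he (h ▸ mem_branchEdges_self hw)) fun x hx hmem => he ?_
    exact branchEdges_subset hG hw (hs x hx).1 (hs x hx).2 hmem
  · intro y z hy hz hyz
    rcases eq_or_exists_mem_branch hp with rfl | ⟨x, hx, hxw, hpx⟩
    · rw [hchild y hy, hchild z hz]
      exact fun h => hcol p hp y z hy hz hyz (σ.injective h)
    · have hmem : ∀ y, G.Adj p y → s(p, y) ∈ branchEdges G q x := fun y hy =>
        ⟨hy, p, by simp, hpx⟩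
      by_cases hxs : x ∈ s
      · rw [hin x hxs _ (hmem y hy), hin x hxs _ (hmem z hz)]
        exact (hg x hxs).1.proper p hpx y z hy hz hyz
      · have hkeep : ∀ y, G.Adj p y → col' s(p, y) = col s(p, y) := fun y hy => by
          refine hout _ (fun h => notMem_branchEdges hG hx hxw (h ▸ hmem y hy)) ?_
          exact fun t ht htm => hxs (eq_of_mem_branchEdges hG hx (hs t ht).1 (hmem y hy) htm ▸ ht)
        rw [hkeep y hy, hkeep z hz]
        exact hcol p hp y z hy hz hyz
  · have hsub : recoloredEdges G col col' ⊆ insert s(w, q) (⋃ x ∈ s, recoloredEdges G col (g x)) := by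
      rintro e ⟨he, hne⟩
      by_cases hew : e = s(w, q)
      · exact .inl hew
      · refine .inr ?_
        by_contra hmem
        simp only [Set.mem_iUnion, not_exists] at hmem
        by_cases h : ∃ x ∈ s, e ∈ branchEdges G q x
        · obtain ⟨x, hx, hxe⟩ := h
          exact hmem x hx ⟨he, hin x hx e hxe ▸ hne⟩
        · push Not at h
          exact hne (hout e hew h)
    calc recourse G col col' ≤ _ := Set.ncard_le_ncard hsub (Set.toFinite _)
      _ ≤ _ := Set.ncard_insert_le _ _
      _ ≤ (∑ x ∈ s, recourse G col (g x)) + 1 := by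
        gcongr
        exact Finset.set_ncard_biUnion_le s _
      _ ≤ (∑ x ∈ s, n x) + 1 := by
        gcongr with x hx
        exact (hg x hx).2
      _ = _ := add_comm _ _

theorem recolorable_one [Finite V] (hG : G.IsAcyclic) (hw : G.Adj w q)
    (hcol : ∀ p ∈ branch G w q, ProperAt G col p)
    (hγ : ∀ x, G.Adj q x → x ≠ w → col s(q, x) ≠ γ) : Recolorable G col w q γ 1 := by
  have h := recolorable_perm hG hw hcol (Equiv.swap (col s(w, q)) γ) ∅ 0 (by simp) (by simp) ?_
  · simpa using h
  · intro x _ hx hxw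
    refine Equiv.swap_apply_of_ne_of_ne ?_ (hγ x hx hxw)
    rw [Sym2.eq_swap (a := w)]
    exact hcol q (mem_branch_self hw) x w hx hw.symm hxw

/-- One step of a Kempe chain: `wq` and `qx` exchange colors, and the conflict moves on to `x`. -/
theorem recolorable_succ [Finite V] (hG : G.IsAcyclic) (hw : G.Adj w q)
    (hcol : ∀ p ∈ branch G w q, ProperAt G col p) (hx : G.Adj q x) (hxw : x ≠ w)
    (h : Recolorable G col q x (col s(w, q)) n) :
    Recolorable G col w q (col s(q, x)) (1 + n) := by
  have h := recolorable_perm hG hw hcol (Equiv.swap (col s(w, q)) (col s(q, x))) {x} (fun _ => n)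
    (by simp [hx, hxw]) (by simpa using h) ?_
  · simpa using h
  · intro y hyx hy hyw
    have hq := hcol q (mem_branch_self hw)
    refine Equiv.swap_apply_of_ne_of_ne ?_ (hq y x hy hx (by simpa using hyx))
    rw [Sym2.eq_swap (a := w)]
    exact hq y w hy hw.symm hyw

/-- Follow the Kempe chain downwards; each step leaves at least one vertex behind. -/
theorem recolorable_card [Finite V] (hG : G.IsAcyclic) (hw : G.Adj w q)
    (hcol : ∀ p ∈ branch G w q, ProperAt G col p) (γ : Fin κ) :
    Recolorable G col w q γ (branch G w q).ncard := by
  induction hN : (branch G w q).ncard using Nat.strong_induction_on generalizing w q γ with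
  | _ N ih =>
    subst hN
    by_cases h : ∃ x, G.Adj q x ∧ x ≠ w ∧ col s(q, x) = γ
    · obtain ⟨x, hx, hxw, rfl⟩ := h
      have hle := branch_card_add_le hG hw {x} (by simp [hx, hxw])
      rw [Finset.sum_singleton] at hle
      have hcol' : ∀ p ∈ branch G q x, ProperAt G col p := fun p hp =>
        hcol p (branch_subset hG hw hx hxw hp)
      exact (recolorable_succ hG hw hcol hx hxw (ih _ (by lia) hx hcol' _ rfl)).mono hle
    · push Not at h
      refine (recolorable_one hG hw hcol h).mono ?_
      simpa using branch_card_add_le hG hw ∅ (by simp)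

open Classical in
/-- The neighbors of `q` other than `w` that are joined to `q` by an edge of color `z`. -/
noncomputable def colorChildren [Fintype V] (G : SimpleGraph V) (col : Sym2 V → Fin κ) (w q : V)
    (z : Fin κ) : Finset V :=
  {y | G.Adj q y ∧ y ≠ w ∧ col s(q, y) = z}

theorem mem_colorChildren [Fintype V] {z : Fin κ} {y : V} :
    y ∈ colorChildren G col w q z ↔ G.Adj q y ∧ y ≠ w ∧ col s(q, y) = z := by
  simp [colorChildren]

theorem recolorable_colorChildren [Fintype V] (hG : G.IsAcyclic) (hw : G.Adj w q)
    (hcol : ∀ p ∈ branch G w q, ProperAt G col p) (γ : Fin κ) :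
    Recolorable G col w q γ (1 + ∑ y ∈ colorChildren G col w q γ, (branch G q y).ncard) := by
  by_cases h : ∃ x, G.Adj q x ∧ x ≠ w ∧ col s(q, x) = γ
  · obtain ⟨x, hx, hxw, rfl⟩ := h
    have hcol' : ∀ p ∈ branch G q x, ProperAt G col p := fun p hp =>
      hcol p (branch_subset hG hw hx hxw hp)
    refine (recolorable_succ hG hw hcol hx hxw (recolorable_card hG hx hcol' _)).mono ?_
    gcongr
    exact Finset.single_le_sum_of_canonicallyOrdered
      (f := fun y => (branch G q y).ncard) (mem_colorChildren.2 ⟨hx, hxw, rfl⟩)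
  · push Not at h
    exact (recolorable_one hG hw hcol h).mono (by lia)

/-- A shortcut leaving the Kempe chain: the colors at `q` are rotated in a 3-cycle, so that `wq`
takes the color of `qx`, `qx` takes `z`, and an edge of color `z` takes the old color of `wq`. -/
theorem recolorable_detour [Fintype V] (hG : G.IsAcyclic) (hw : G.Adj w q)
    (hcol : ∀ p ∈ branch G w q, ProperAt G col p) (hx : G.Adj q x) (hxw : x ≠ w) {z : Fin κ}
    (hzx : z ≠ col s(q, x)) (hzw : z ≠ col s(w, q)) (h : Recolorable G col q x z n) :
    Recolorable G col w q (col s(q, x))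
      (1 + (n + ∑ y ∈ colorChildren G col w q z, (branch G q y).ncard)) := by
  classical
  have hq := hcol q (mem_branch_self hw)
  have hne : col s(q, x) ≠ col s(w, q) := by
    rw [Sym2.eq_swap (a := w)]
    exact hq x w hx hw.symm hxw
  have hxC : x ∉ colorChildren G col w q z := fun h => hzx (mem_colorChildren.1 h).2.2.symm
  set σ : Equiv.Perm (Fin κ) :=
    Equiv.swap (col s(w, q)) (col s(q, x)) * Equiv.swap (col s(q, x)) z with hσ
  have hσx : σ (col s(q, x)) = z := by
    rw [hσ, Equiv.Perm.mul_apply, Equiv.swap_apply_left, Equiv.swap_apply_of_ne_of_ne hzw hzx]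
  have hσz : σ z = col s(w, q) := by
    rw [hσ, Equiv.Perm.mul_apply, Equiv.swap_apply_right, Equiv.swap_apply_right]
  have hσw : σ (col s(w, q)) = col s(q, x) := by
    rw [hσ, Equiv.Perm.mul_apply, Equiv.swap_apply_of_ne_of_ne hne.symm hzw.symm,
      Equiv.swap_apply_left]
  have hmain := recolorable_perm hG hw hcol σ (insert x (colorChildren G col w q z))
    (fun y => if y = x then n else (branch G q y).ncard) ?_ ?_ ?_
  · rw [hσw, Finset.sum_insert hxC, if_pos rfl] at hmain
    convert hmain using 4 with y hy
    rw [if_neg (by rintro rfl; exact hxC hy)]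
  · intro y hy
    rcases Finset.mem_insert.1 hy with rfl | hy
    · exact ⟨hx, hxw⟩
    · exact ⟨(mem_colorChildren.1 hy).1, (mem_colorChildren.1 hy).2.1⟩
  · intro y hy
    rcases Finset.mem_insert.1 hy with rfl | hy
    · rwa [hσx, if_pos rfl]
    · obtain ⟨hqy, hyw, hyz⟩ := mem_colorChildren.1 hy
      rw [if_neg fun h : y = x => hxC (h ▸ hy)]
      exact recolorable_card hG hqy (fun p hp => hcol p (branch_subset hG hw hqy hyw hp)) _
  · intro y hy hqy hyw
    rw [Finset.mem_insert, not_or] at hy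
    have hyx := hq y x hqy hx hy.1
    have hyz : col s(q, y) ≠ z := fun h => hy.2 (mem_colorChildren.2 ⟨hqy, hyw, h⟩)
    have hyw' : col s(q, y) ≠ col s(w, q) := by
      rw [Sym2.eq_swap (a := w)]
      exact hq y w hqy hw.symm hyw
    rw [hσ, Equiv.Perm.mul_apply, Equiv.swap_apply_of_ne_of_ne hyx hyz,
      Equiv.swap_apply_of_ne_of_ne hyw' hyx]

theorem sum_colorChildren_add_le [Fintype V] (hG : G.IsAcyclic) (hw : G.Adj w q)
    (hx : G.Adj q x) (hxw : x ≠ w) (S : Finset (Fin κ)) (hS : col s(q, x) ∉ S) :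
    1 + (branch G q x).ncard + ∑ z ∈ S, ∑ y ∈ colorChildren G col w q z, (branch G q y).ncard ≤
      (branch G w q).ncard := by
  classical
  have hdisj : (S : Set (Fin κ)).PairwiseDisjoint (colorChildren G col w q) := by
    intro z _ z' _ hzz
    refine Finset.disjoint_left.2 fun y hy hy' => hzz ?_
    rw [← (mem_colorChildren.1 hy).2.2, (mem_colorChildren.1 hy').2.2]
  rw [← Finset.sum_biUnion hdisj, add_assoc, ← Finset.sum_insert (f := fun y => (branch G q y).ncard)]
  · refine branch_card_add_le hG hw _ fun y hy => ?_
    rcases Finset.mem_insert.1 hy with rfl | hy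
    · exact ⟨hx, hxw⟩
    · obtain ⟨z, _, hy⟩ := Finset.mem_biUnion.1 hy
      exact ⟨(mem_colorChildren.1 hy).1, (mem_colorChildren.1 hy).2.1⟩
  · intro h
    obtain ⟨z, hz, hy⟩ := Finset.mem_biUnion.1 h
    exact hS ((mem_colorChildren.1 hy).2.2 ▸ hz)

/-! ### The quadratic lower bound on the branch size -/

/-- Recoloring a branch at its root edge is so cheap that the size of the branch is at least
quadratic in the cost. -/
theorem exists_recolorable_sq_le [Fintype V] (hG : G.IsAcyclic) (hw : G.Adj w q)
    (hcol : ∀ p ∈ branch G w q, ProperAt G col p) (γ : Fin κ) :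
    ∃ n, Recolorable G col w q γ n ∧ (κ - 2) * ((n - 2) * n) ≤ 4 * (branch G w q).ncard := by
  classical
  induction hN : (branch G w q).ncard using Nat.strong_induction_on generalizing w q γ with
  | _ N ih =>
  subst hN
  have hex : ∃ n, Recolorable G col w q γ n := ⟨_, recolorable_card hG hw hcol γ⟩
  obtain ⟨n, hn, hmin⟩ : ∃ n, Recolorable G col w q γ n ∧ ∀ m, Recolorable G col w q γ m → n ≤ m :=
    ⟨Nat.find hex, Nat.find_spec hex, fun m hm => Nat.find_min' hex hm⟩
  refine ⟨n, hn, ?_⟩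
  rcases le_or_gt n 2 with hn2 | hn2
  · simp [Nat.sub_eq_zero_of_le hn2]
  have hq := hcol q (mem_branch_self hw)
  -- A minimal cost above two forces the alternating chain to continue for two more edges, `qx` and
  -- `xy`.
  obtain ⟨x, hx, hxw, rfl⟩ : ∃ x, G.Adj q x ∧ x ≠ w ∧ col s(q, x) = γ := by
    by_contra! h
    have := hmin _ (recolorable_one hG hw hcol h)
    lia
  have hcolx : ∀ p ∈ branch G q x, ProperAt G col p := fun p hp =>
    hcol p (branch_subset hG hw hx hxw hp)
  obtain ⟨y, hy, hyq, hyc⟩ : ∃ y, G.Adj x y ∧ y ≠ q ∧ col s(x, y) = col s(w, q) := by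
    by_contra! h
    have := hmin _ (recolorable_succ hG hw hcol hx hxw (recolorable_one hG hx hcolx h))
    lia
  have hcoly : ∀ p ∈ branch G x y, ProperAt G col p := fun p hp =>
    hcolx p (branch_subset hG hx hy hyq hp)
  set S : Finset (Fin κ) := Finset.univ \ {col s(q, x), col s(w, q)} with hS
  have hSx : col s(q, x) ∉ S := by simp [hS]
  have hSy : col s(x, y) ∉ S := by simp [hS, hyc]
  have hScard : κ - 2 ≤ S.card := by
    have h1 := Finset.le_card_sdiff {col s(q, x), col s(w, q)} (Finset.univ : Finset (Fin κ))
    have h2 := Finset.card_le_two (a := col s(q, x)) (b := col s(w, q))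
    rw [Finset.card_univ, Fintype.card_fin] at h1
    lia
  have hle1 := sum_colorChildren_add_le (col := col) hG hw hx hxw S hSx
  have hle2 := sum_colorChildren_add_le (col := col) hG hx hy hyq S hSy
  obtain ⟨n', hn', hle'⟩ := ih _ (by lia) hy hcoly (col s(q, x)) rfl
  have hnn' : n ≤ 1 + (1 + n') := by
    refine hmin _ (recolorable_succ hG hw hcol hx hxw ?_)
    rw [← hyc]
    exact recolorable_succ hG hx hcolx hy hyq hn'
  -- For each third color `z`, the detour costs two plus the sizes of the `z`-branches at `q` and at
  -- `x`, and minimality of `n` bounds this from below. These side branches are disjoint for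
  -- different `z` and disjoint from the branch of `y`.
  have hsum : S.card * (n - 2) ≤
      (∑ z ∈ S, ∑ y ∈ colorChildren G col w q z, (branch G q y).ncard) +
        ∑ z ∈ S, ∑ y ∈ colorChildren G col q x z, (branch G x y).ncard := by
    rw [← Finset.sum_add_distrib, ← smul_eq_mul]
    refine Finset.card_nsmul_le_sum _ _ _ fun z hz => ?_
    simp only [hS, Finset.mem_sdiff, Finset.mem_insert, Finset.mem_singleton, not_or] at hz
    have := hmin _ (recolorable_detour hG hw hcol hx hxw hz.2.1 hz.2.2
      (recolorable_colorChildren hG hx hcolx z))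
    lia
  -- Since `n' ≥ n - 2`, this rests on n(n-2) - (n-2)(n-4) = 4(n-2); `n = 3` is separate because of
  -- truncated subtraction.
  have hquad : (n - 2) * n ≤ 4 * (n - 2) + (n' - 2) * n' := by
    obtain ⟨a, rfl⟩ := Nat.exists_eq_add_of_lt hn2
    rcases a with _ | b
    · lia
    · obtain ⟨d, rfl⟩ := Nat.exists_eq_add_of_le (show b + 2 ≤ n' by lia)
      have h1 : 2 + (b + 1) + 1 - 2 = b + 2 := by lia
      have h2 : b + 2 + d - 2 = b + d := by lia
      rw [h1, h2]
      nlinarith [Nat.zero_le (b * d), Nat.zero_le (d * d)]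
  calc (κ - 2) * ((n - 2) * n) ≤ (κ - 2) * (4 * (n - 2) + (n' - 2) * n') := by gcongr
    _ = 4 * ((κ - 2) * (n - 2)) + (κ - 2) * ((n' - 2) * n') := by ring
    _ ≤ 4 * (S.card * (n - 2)) + 4 * (branch G x y).ncard := by gcongr
    _ ≤ _ := by lia

end Recolor

/-! ### The recourse of a single insertion -/

section Insertion

variable {V : Type*} {κ : ℕ} {G G' : SimpleGraph V} {col col' : Sym2 V → Fin κ} {u v p : V}

theorem disjoint_branch (hG : G.IsAcyclic) (h : G.Adj u v) :
    Disjoint (branch G u v) (branch G v u) := by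
  rw [Set.disjoint_left]
  rintro p ⟨P, hP, hu⟩ ⟨Q, hQ, hv⟩
  have h1 := (hG.subsingleton_path _ _).elim ⟨.cons h P, (Walk.cons_isPath_iff _ _).2 ⟨hP, hu⟩⟩
    ⟨Q, hQ⟩
  have h2 := congrArg (fun P : G.Path u p => P.1.support) h1
  simp only at h2
  rw [← h2] at hv
  exact hv (by simp)

/-- The number of vertices in the connected component of `x`. -/
noncomputable def componentSize (G : SimpleGraph V) (x : V) : ℕ := {y | G.Reachable x y}.ncard

theorem componentSize_pos [Finite V] (G : SimpleGraph V) (x : V) : 1 ≤ componentSize G x :=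
  (Set.ncard_pos (Set.toFinite _)).2 ⟨x, Reachable.refl x⟩

theorem componentSize_mono [Finite V] (h : G ≤ G') (x : V) :
    componentSize G x ≤ componentSize G' x :=
  Set.ncard_le_ncard (fun _ hy => Reachable.mono h hy) (Set.toFinite _)

/-- `G'` arises from `G` by adding the edge `uv`. -/
structure IsInsertion (G G' : SimpleGraph V) (u v : V) : Prop where
  le : G ≤ G'
  adj : G'.Adj u v
  not_adj : ¬ G.Adj u v
  adj_or : ∀ x y, G'.Adj x y → G.Adj x y ∨ s(x, y) = s(u, v)

theorem IsInsertion.symm (h : IsInsertion G G' u v) : IsInsertion G G' v u :=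
  ⟨h.le, h.adj.symm, fun h' => h.not_adj h'.symm, fun x y hxy => by
    rw [Sym2.eq_swap (a := v)]; exact h.adj_or x y hxy⟩

theorem componentSize_le_of_mem_branch [Finite V] (hG : G'.IsAcyclic) (h : IsInsertion G G' u v)
    (hp : p ∈ branch G' u v) : componentSize G p ≤ (branch G' u v).ncard := by
  refine Set.ncard_le_ncard ?_ (Set.toFinite _)
  rintro y ⟨P⟩
  induction P with
  | nil => exact hp
  | cons hadj P ih =>
    refine ih ?_
    by_contra hnot
    obtain ⟨rfl, rfl⟩ := eq_and_eq_of_adj_of_notMem_branch hG h.adj (h.le hadj) hp hnot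
    exact h.not_adj hadj.symm

theorem reachable_of_mem_branch (hp : p ∈ branch G u v) : G.Reachable v p :=
  let ⟨P, _⟩ := hp
  ⟨P⟩

theorem branch_add_branch_le [Finite V] (hG : G.IsAcyclic) (h : G.Adj u v)
    (hp : p ∈ branch G u v) :
    (branch G u v).ncard + (branch G v u).ncard ≤ componentSize G p := by
  rw [← Set.ncard_union_eq (disjoint_branch hG h) (Set.toFinite _) (Set.toFinite _)]
  refine Set.ncard_le_ncard (Set.union_subset ?_ ?_) (Set.toFinite _)
  · exact fun y hy => (reachable_of_mem_branch hp).symm.trans (reachable_of_mem_branch hy)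
  · exact fun y hy => ((reachable_of_mem_branch hp).symm.trans h.symm.reachable).trans
      (reachable_of_mem_branch hy)

/-- Give the new edge a color free at `u`, then recolor only the side of `u` so that this edge
receives a color free at `v`. By symmetry the bound holds for either side. -/
theorem IsGreedyUpdate.recourse_sq_le [Finite V] (hG : G'.IsAcyclic) (h : IsInsertion G G' u v)
    (hcol : IsProperEdgeColoring G col) (hgreedy : IsGreedyUpdate G G' col col')
    (hu : ∃ a, ∀ y, G.Adj u y → col s(u, y) ≠ a) (hv : ∃ b, ∀ y, G.Adj v y → col s(v, y) ≠ b) :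
    (κ - 2) * ((recourse G col col' - 2) * recourse G col col') ≤
      4 * (branch G' v u).ncard := by
  classical
  cases nonempty_fintype V
  obtain ⟨a, ha⟩ := hu
  obtain ⟨b, hb⟩ := hv
  set col₀ := Function.update col s(v, u) a with hcol₀
  have hold : ∀ e ∈ G.edgeSet, col₀ e = col e := fun e he => by
    refine Function.update_of_ne ?_ _ _
    rintro rfl
    exact h.symm.not_adj he
  have hproper₀ : ∀ p ∈ branch G' v u, ProperAt G' col₀ p := by
    intro p hp y z hy hz hyz
    have hpv : p ≠ v := by
      rintro rfl
      exact notMem_branch hp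
    have key : ∀ y z, G'.Adj p y → G'.Adj p z → y ≠ z → ¬ G.Adj p y →
        col₀ s(p, y) ≠ col₀ s(p, z) := by
      intro y z hy hz hyz hny
      have h1 := (h.adj_or p y hy).resolve_left hny
      obtain ⟨rfl, rfl⟩ : p = u ∧ y = v := by
        rcases Sym2.eq_iff.1 h1 with h | h
        · exact h
        · exact absurd h.1 hpv
      have h2 : G.Adj p z := (h.adj_or p z hz).resolve_right fun h2 => by
        rw [Sym2.congr_right] at h2
        exact hyz h2.symm
      rw [hold s(p, z) h2, Sym2.eq_swap, hcol₀, Function.update_self]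
      exact (ha z h2).symm
    by_cases hy' : G.Adj p y
    · by_cases hz' : G.Adj p z
      · rw [hold _ hy', hold _ hz']
        exact hcol p y z hy' hz' hyz
      · exact (key z y hz hy hyz.symm hz').symm
    · exact key y z hy hz hyz hy'
  obtain ⟨n, ⟨c, hc, hcn⟩, hn⟩ := exists_recolorable_sq_le hG h.symm.adj hproper₀ b
  have hc_old : ∀ p y, p ∉ branch G' v u → G'.Adj p y → s(p, y) ≠ s(v, u) →
      c s(p, y) = col s(p, y) ∧ G.Adj p y := by
    intro p y hp hy hne
    have hadj : G.Adj p y := (h.symm.adj_or p y hy).resolve_right hne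
    refine ⟨?_, hadj⟩
    rw [hc.eq_off, hold _ hadj]
    intro hmem
    obtain ⟨rfl, rfl⟩ := eq_or_eq_of_mem_branchEdges hG h.symm.adj hmem hp
    exact hne rfl
  have hproper : IsProperEdgeColoring G' c := by
    intro p y z hy hz hyz
    by_cases hp : p ∈ branch G' v u
    · exact hc.proper p hp y z hy hz hyz
    have key : ∀ y z, G'.Adj p y → G'.Adj p z → y ≠ z → s(p, y) = s(v, u) →
        c s(p, y) ≠ c s(p, z) := by
      intro y z hy hz hyz hyvu
      have hpu : p ≠ u := by
        rintro rfl
        exact hp (mem_branch_self h.symm.adj)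
      obtain ⟨rfl, rfl⟩ : p = v ∧ y = u := by
        rcases Sym2.eq_iff.1 hyvu with h | h
        · exact h
        · exact absurd h.1 hpu
      obtain ⟨h1, h2⟩ := hc_old p z hp hz fun h => by
        rw [Sym2.congr_right] at h
        exact hyz h.symm
      rw [hc.root, h1]
      exact (hb z h2).symm
    by_cases hy' : s(p, y) = s(v, u)
    · exact key y z hy hz hyz hy'
    by_cases hz' : s(p, z) = s(v, u)
    · exact (key z y hz hy hyz.symm hz').symm
    obtain ⟨h1, h2⟩ := hc_old p y hp hy hy'
    obtain ⟨h3, h4⟩ := hc_old p z hp hz hz'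
    rw [h1, h3]
    exact hcol p y z h2 h4 hyz
  have hle : recourse G col col' ≤ n := by
    refine (hgreedy.2 c hproper).trans (le_trans ?_ hcn)
    refine Set.ncard_le_ncard ?_ (Set.toFinite _)
    rintro e ⟨he, hne⟩
    exact ⟨edgeSet_mono h.le he, by rwa [hold e he]⟩
  calc _ ≤ (κ - 2) * ((n - 2) * n) := by gcongr
    _ ≤ _ := hn

/-! ### The potential -/

/-- The potential of a vertex in a component with `s` vertices. -/
noncomputable def potential (κ s : ℕ) : ℝ := -(1 / √(max (4 * s) κ : ℝ))

theorem potential_mono {κ : ℕ} (hκ : 0 < κ) : Monotone (potential κ) := by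
  intro s t hst
  unfold potential
  have h0 : (0 : ℝ) < κ := by exact_mod_cast hκ
  have hst' : (s : ℝ) ≤ t := by exact_mod_cast hst
  have : 0 < √(max (4 * s) κ : ℝ) := Real.sqrt_pos.2 (lt_max_of_lt_right h0)
  gcongr

theorem sum_potential_mono [Fintype V] (hκ : 0 < κ) (h : G ≤ G') :
    ∑ x, potential κ (componentSize G x) ≤ ∑ x, potential κ (componentSize G' x) :=
  Finset.sum_le_sum fun x _ => potential_mono hκ (componentSize_mono h x)

/-- Above the cutoff the right side is 4√m(1 - 1/√2), and 1/√2 ≤ 3/4. -/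
theorem sqrt_le_mul_potential_sub {κ m : ℕ} (hκ : 0 < κ) (hm : κ ≤ 4 * m) :
    √(m : ℝ) ≤ 8 * (m * (potential κ (2 * m) - potential κ m)) := by
  have hm0 : 0 < (m : ℝ) := by
    have : 0 < m := by lia
    exact_mod_cast this
  have hm' : (κ : ℝ) ≤ 4 * m := by exact_mod_cast hm
  have h1 : √(max (4 * m) κ : ℝ) = 2 * √m := by
    rw [max_eq_left hm', Real.sqrt_mul (by norm_num), show (4 : ℝ) = 2 ^ 2 by norm_num,
      Real.sqrt_sq (by norm_num)]
  have h2 : √(max (4 * (2 * m : ℕ)) κ : ℝ) = 2 * (√2 * √m) := by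
    push_cast
    rw [max_eq_left (by linarith), Real.sqrt_mul (by norm_num), Real.sqrt_mul (by norm_num),
      show √(4 : ℝ) = 2 by rw [show (4 : ℝ) = 2 ^ 2 by norm_num, Real.sqrt_sq (by norm_num)]]
  unfold potential
  rw [h1, h2]
  have hs : 0 < √(m : ℝ) := Real.sqrt_pos.2 hm0
  have hsq : √(m : ℝ) * √m = m := Real.mul_self_sqrt hm0.le
  have h2p : 0 < √(2 : ℝ) := by positivity
  have h43 : (4 / 3 : ℝ) ≤ √2 := Real.le_sqrt_of_sq_le (by norm_num)
  have heq : (8 : ℝ) * (m * (-(1 / (2 * (√2 * √m))) - -(1 / (2 * √m)))) =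
      √m * (4 * (1 - 1 / √2)) := by
    generalize √(m : ℝ) = s at hs hsq
    rw [← hsq]
    field_simp
    ring
  rw [heq]
  have : 1 / √(2 : ℝ) ≤ 3 / 4 := by
    rw [div_le_iff₀ h2p]
    linarith
  nlinarith

/-- Each vertex on the smaller side, of size m, passes from a component of size at most m to one of
size at least 2m; no other vertex loses potential. -/
theorem mul_sub_le_sum_potential [Fintype V] (hκ : 0 < κ) (hG : G'.IsAcyclic)
    (h : IsInsertion G G' u v) (hle : (branch G' u v).ncard ≤ (branch G' v u).ncard) :
    ((branch G' u v).ncard : ℝ) * (potential κ (2 * (branch G' u v).ncard) -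
      potential κ (branch G' u v).ncard) ≤
      ∑ x, potential κ (componentSize G' x) - ∑ x, potential κ (componentSize G x) := by
  classical
  rw [← Finset.sum_sub_distrib, Set.ncard_eq_toFinset_card' (branch G' u v), ← nsmul_eq_mul]
  refine (Finset.card_nsmul_le_sum (branch G' u v).toFinset
    (fun x => potential κ (componentSize G' x) - potential κ (componentSize G x)) _ ?_).trans
      (Finset.sum_le_univ_sum_of_nonneg ?_)
  · intro x hx
    rw [Set.mem_toFinset] at hx
    rw [← Set.ncard_eq_toFinset_card']
    refine sub_le_sub (potential_mono hκ ?_) (potential_mono hκ ?_)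
    · have := branch_add_branch_le hG h.adj hx
      lia
    · exact componentSize_le_of_mem_branch hG h hx
  · exact fun x => sub_nonneg.2 (potential_mono hκ (componentSize_mono h.le x))

theorem le_mul_sum_potential [Fintype V] (hκ : 3 ≤ κ) (hG : G'.IsAcyclic)
    (h : IsInsertion G G' u v) (hle : (branch G' u v).ncard ≤ (branch G' v u).ncard) {r : ℕ}
    (hr : 3 ≤ r) (hsq : (κ - 2) * ((r - 2) * r) ≤ 4 * (branch G' u v).ncard) :
    (r : ℝ) ≤ 48 / √κ *
      (∑ x, potential κ (componentSize G' x) - ∑ x, potential κ (componentSize G x)) := by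
  set m := (branch G' u v).ncard with hm
  -- From `κ ≤ 3 * (κ - 2)` and `r ≤ 3 * (r - 2)`, as both are at least three.
  have hsq' : κ * r ^ 2 ≤ 36 * m := by
    obtain ⟨a, rfl⟩ := Nat.exists_eq_add_of_le hκ
    obtain ⟨b, rfl⟩ := Nat.exists_eq_add_of_le hr
    rw [show 3 + a - 2 = a + 1 by lia, show 3 + b - 2 = b + 1 by lia] at hsq
    calc (3 + a) * (3 + b) ^ 2 ≤ (3 * (a + 1)) * ((3 * (b + 1)) * (3 + b)) := by
          rw [sq]
          gcongr <;> lia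
      _ = 9 * ((a + 1) * ((b + 1) * (3 + b))) := by ring
      _ ≤ _ := by lia
  -- With `r ≥ 3` the components are past the cutoff of the potential.
  have hκm : κ ≤ 4 * m := by
    have : κ * 3 ^ 2 ≤ κ * r ^ 2 := by gcongr
    lia
  have h1 := (sqrt_le_mul_potential_sub (by lia) hκm).trans
    (mul_le_mul_of_nonneg_left (mul_sub_le_sum_potential (κ := κ) (by lia) hG h hle)
      (by norm_num : (0 : ℝ) ≤ 8))
  have hκ0 : 0 < √(κ : ℝ) := Real.sqrt_pos.2 (by exact_mod_cast (by lia : 0 < κ))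
  have h2 : √(κ : ℝ) * r ≤ 6 * √(m : ℝ) := by
    have h3 : ((κ : ℝ) * (r : ℝ) ^ 2) ≤ 36 * m := by exact_mod_cast hsq'
    have h4 := Real.sqrt_le_sqrt h3
    rwa [Real.sqrt_mul (by positivity), Real.sqrt_sq (by positivity), Real.sqrt_mul (by norm_num),
      show √(36 : ℝ) = 6 by rw [show (36 : ℝ) = 6 ^ 2 by norm_num, Real.sqrt_sq (by norm_num)]]
      at h4
  rw [div_mul_eq_mul_div, le_div_iff₀ hκ0]
  nlinarith

/-- The recourse of a greedy update exceeding two is paid for by the increase of the potential. -/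
theorem IsGreedyUpdate.recourse_le [Fintype V] (hκ : 3 ≤ κ) (hG : G'.IsAcyclic)
    (h : IsInsertion G G' u v) (hcol : IsProperEdgeColoring G col)
    (hgreedy : IsGreedyUpdate G G' col col')
    (hu : ∃ a, ∀ y, G.Adj u y → col s(u, y) ≠ a) (hv : ∃ b, ∀ y, G.Adj v y → col s(v, y) ≠ b)
    (hr : 3 ≤ recourse G col col') :
    (recourse G col col' : ℝ) ≤ 48 / √κ *
      (∑ x, potential κ (componentSize G' x) - ∑ x, potential κ (componentSize G x)) := by
  have h1 := hgreedy.recourse_sq_le hG h hcol hu hv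
  have h2 := hgreedy.recourse_sq_le hG h.symm hcol hv hu
  rcases le_total (branch G' u v).ncard (branch G' v u).ncard with hle | hle
  · exact le_mul_sum_potential hκ hG h hle hr h2
  · exact le_mul_sum_potential hκ hG h.symm hle hr h1

end Insertion

/-! ### Counting the insertions of positive recourse -/

/-- The edges of a forest can be assigned to endpoints such that no vertex is used twice. -/
theorem exists_injOn_endpoint {V : Type*} {G : SimpleGraph V} (hG : G.IsAcyclic) :
    ∃ f : Sym2 V → V, (∀ e ∈ G.edgeSet, f e ∈ e) ∧ Set.InjOn f G.edgeSet := by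
  classical
  have hpath : ∀ x, ∃ P : G.Walk (G.connectedComponentMk x).out x, P.IsPath := fun x =>
    have h : G.Reachable (G.connectedComponentMk x).out x :=
      ConnectedComponent.exact (Quot.out_eq (G.connectedComponentMk x))
    h.exists_isPath
  choose P hP using hpath
  -- Root every component; an edge goes to its endpoint farther from the root, which determines it
  -- as the last edge of the path from the root.
  have hpar : ∀ e, ∃ x ∈ e, e ∈ G.edgeSet → e = s((P x).penultimate, x) := by
    intro e
    induction e using Sym2.ind with
    | _ x y =>
    by_cases hadj : G.Adj x y
    swap
    · exact ⟨x, by simp, fun he => absurd he hadj⟩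
    have hroot : (G.connectedComponentMk x).out = (G.connectedComponentMk y).out := by
      rw [ConnectedComponent.sound hadj.reachable]
    by_cases hmem : y ∈ (P x).support
    · refine ⟨x, by simp, fun _ => ?_⟩
      rw [← hG.eq_penultimate_of_adj_end (hP x) hadj hmem, Sym2.eq_swap]
    · refine ⟨y, by simp, fun _ => ?_⟩
      have hx : x ∈ (P y).support := by
        have h1 : ((P x).copy hroot rfl).IsPath := by simpa using hP x
        exact hG.mem_support_of_ne_mem_support_of_adj_of_isPath (hP y) h1 hadj.symm
          (by simpa using hmem)
      rw [← hG.eq_penultimate_of_adj_end (hP y) hadj.symm hx]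
  choose f hf hf' using hpar
  refine ⟨f, fun e _ => hf e, fun e he e' he' h => ?_⟩
  rw [hf' e he, hf' e' he', h]

namespace InsertionSequence

variable {V : Type*} {Δ κ : ℕ} (σ : InsertionSequence V Δ)

open Classical in
/-- The number of the first `t` edges that contain `v`. -/
noncomputable def degreeAt (t : ℕ) (v : V) : ℕ :=
  (Finset.univ.filter fun i : Fin σ.length => i.val < t ∧ v ∈ σ.edge i).card

theorem forest_adj {t : ℕ} {x y : V} :
    (σ.forest t).Adj x y ↔ ∃ i : Fin σ.length, i.val < t ∧ σ.edge i = s(x, y) := by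
  simp only [forest, fromEdgeSet_adj, Set.mem_ofPred_eq]
  refine ⟨fun h => h.1, fun ⟨i, hi, h⟩ => ⟨⟨i, hi, h⟩, fun hxy => σ.not_isDiag i ?_⟩⟩
  rw [h, hxy]
  exact Sym2.mk_isDiag_iff.2 rfl

theorem forest_mono {t t' : ℕ} (h : t ≤ t') : σ.forest t ≤ σ.forest t' := fun x y hxy => by
  obtain ⟨i, hi, he⟩ := σ.forest_adj.1 hxy
  exact σ.forest_adj.2 ⟨i, hi.trans_le h, he⟩

theorem degreeAt_mono {t t' : ℕ} (h : t ≤ t') (v : V) : σ.degreeAt t v ≤ σ.degreeAt t' v := by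
  classical
  exact Finset.card_le_card fun i hi => by
    simp only [Finset.mem_filter, Finset.mem_univ, true_and] at hi ⊢
    exact ⟨hi.1.trans_le h, hi.2⟩

theorem degreeAt_succ_le {t : Fin σ.length} {v : V} (hv : v ∈ σ.edge t) :
    σ.degreeAt t v + 1 ≤ σ.degreeAt (t + 1) v := by
  classical
  refine Finset.card_lt_card (Finset.ssubset_iff_of_subset ?_ |>.2 ⟨t, by simp [hv], by simp⟩)
  intro i hi
  simp only [Finset.mem_filter, Finset.mem_univ, true_and] at hi ⊢
  exact ⟨hi.1.trans (Nat.lt_succ_self _), hi.2⟩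

theorem degreeAt_le {t : ℕ} (ht : t ≤ σ.length) (v : V) : σ.degreeAt t v ≤ Δ := by
  classical
  have hother : ∀ i : Fin σ.length, ∃ y, v ∈ σ.edge i → σ.edge i = s(v, y) := fun i => by
    by_cases hv : v ∈ σ.edge i
    · obtain ⟨y, hy⟩ := hv
      exact ⟨y, fun _ => hy⟩
    · exact ⟨v, fun h => absurd h hv⟩
  choose f hf using hother
  set S := Finset.univ.filter fun i : Fin σ.length => i.val < t ∧ v ∈ σ.edge i with hS
  have hmem : ∀ i ∈ S, i.val < t ∧ v ∈ σ.edge i := by simp [hS]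
  have hinj : Set.InjOn f S := by
    intro i hi j hj hij
    refine σ.injective ?_
    rw [hf i (hmem i hi).2, hf j (hmem j hj).2, hij]
  have hsub : ((S.image f : Finset V) : Set V) ⊆ (σ.forest t).neighborSet v := by
    intro y hy
    obtain ⟨i, hi, rfl⟩ := Finset.mem_image.1 hy
    exact σ.forest_adj.2 ⟨i, (hmem i hi).1, hf i (hmem i hi).2⟩
  have h1 := (Set.encard_le_encard hsub).trans (σ.degree_le t ht v)
  rw [Set.encard_coe_eq_coe_finsetCard, Finset.card_image_of_injOn hinj] at h1
  exact_mod_cast h1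

theorem sum_degreeAt_le [Fintype V] (t : ℕ) : ∑ v, σ.degreeAt t v ≤ 2 * σ.length := by
  classical
  have h1 : ∑ v, σ.degreeAt t v ≤
      ∑ v, (Finset.univ.filter fun i : Fin σ.length => v ∈ σ.edge i).card :=
    Finset.sum_le_sum fun v _ => Finset.card_le_card fun i hi => by
      simp only [Finset.mem_filter, Finset.mem_univ, true_and] at hi ⊢
      exact hi.2
  refine h1.trans ?_
  simp only [Finset.card_filter]
  rw [Finset.sum_comm]
  refine (Finset.sum_le_card_nsmul _ _ 2 fun i _ => ?_).trans (by simp [mul_comm])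
  rw [← Finset.card_filter]
  generalize σ.edge i = e
  induction e using Sym2.ind with
  | _ x y =>
  refine (Finset.card_le_card (t := {x, y}) fun z hz => ?_).trans Finset.card_le_two
  simpa using hz

theorem isInsertion {t : Fin σ.length} {u v : V} (h : σ.edge t = s(u, v)) :
    IsInsertion (σ.forest t) (σ.forest (t + 1)) u v where
  le := σ.forest_mono (Nat.le_succ _)
  adj := σ.forest_adj.2 ⟨t, Nat.lt_succ_self _, h⟩
  not_adj h' := by
    obtain ⟨i, hi, he⟩ := σ.forest_adj.1 h'
    obtain rfl := σ.injective (he.trans h.symm)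
    exact lt_irrefl _ hi
  adj_or x y hxy := by
    obtain ⟨i, hi, he⟩ := σ.forest_adj.1 hxy
    rcases (Nat.lt_succ_iff.1 hi).lt_or_eq with hlt | heq
    · exact .inl (σ.forest_adj.2 ⟨i, hlt, he⟩)
    · exact .inr (by rw [← he, ← h, Fin.ext heq])

open Classical in
/-- The colors at `v` after `t` insertions. -/
noncomputable def colorsAt (t : ℕ) (col : Sym2 V → Fin κ) (v : V) : Finset (Fin κ) :=
  (Finset.univ.filter fun i : Fin σ.length => i.val < t ∧ v ∈ σ.edge i).image fun i =>
    col (σ.edge i)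

theorem card_colorsAt_le (t : ℕ) (col : Sym2 V → Fin κ) (v : V) :
    (σ.colorsAt t col v).card ≤ σ.degreeAt t v :=
  Finset.card_image_le

theorem mem_colorsAt {t : ℕ} (col : Sym2 V → Fin κ) {v y : V} (h : (σ.forest t).Adj v y) :
    col s(v, y) ∈ σ.colorsAt t col v := by
  classical
  obtain ⟨i, hi, he⟩ := σ.forest_adj.1 h
  exact Finset.mem_image.2 ⟨i, by simp [hi, he], by rw [he]⟩

theorem exists_missing {t : ℕ} (col : Sym2 V → Fin κ) {v : V} (h : σ.degreeAt t v < κ) :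
    ∃ a, ∀ y, (σ.forest t).Adj v y → col s(v, y) ≠ a := by
  obtain ⟨a, ha⟩ : ∃ a, a ∉ σ.colorsAt t col v := by
    by_contra! hall
    have h1 : κ ≤ (σ.colorsAt t col v).card := by
      rw [Finset.eq_univ_of_forall hall, Finset.card_univ, Fintype.card_fin]
    have := σ.card_colorsAt_le t col v
    lia
  exact ⟨a, fun y hy hya => ha (hya ▸ σ.mem_colorsAt col hy)⟩

/-- Otherwise some color is free at both endpoints, and using it for the new edge recolors nothing.
-/
theorem le_degreeAt_add_of_recourse_pos [Finite V] {t : Fin σ.length} {u v : V}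
    (h : σ.edge t = s(u, v)) {col col' : Sym2 V → Fin κ}
    (hcol : IsProperEdgeColoring (σ.forest t) col)
    (hgreedy : IsGreedyUpdate (σ.forest t) (σ.forest (t + 1)) col col')
    (hpos : 1 ≤ recourse (σ.forest t) col col') :
    κ ≤ σ.degreeAt t u + σ.degreeAt t v := by
  classical
  by_contra! hlt
  obtain ⟨a, ha⟩ : ∃ a, a ∉ σ.colorsAt t col u ∪ σ.colorsAt t col v := by
    by_contra! hall
    have h1 : κ ≤ (σ.colorsAt t col u ∪ σ.colorsAt t col v).card := by
      rw [Finset.eq_univ_of_forall hall, Finset.card_univ, Fintype.card_fin]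
    have h2 := Finset.card_union_le (σ.colorsAt t col u) (σ.colorsAt t col v)
    have := σ.card_colorsAt_le t col u
    have := σ.card_colorsAt_le t col v
    lia
  rw [Finset.mem_union, not_or] at ha
  have hins := σ.isInsertion h
  have hold : ∀ e ∈ (σ.forest t).edgeSet, Function.update col s(u, v) a e = col e := by
    intro e he
    refine Function.update_of_ne ?_ _ _
    rintro rfl
    exact hins.not_adj he
  have hends : ∀ x y, s(x, y) = s(u, v) → ∀ z, (σ.forest t).Adj x z → col s(x, z) ≠ a := by
    intro x y hxy z hz hza
    have hmem := hza ▸ σ.mem_colorsAt col hz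
    rcases Sym2.eq_iff.1 hxy with h | h
    · exact ha.1 (h.1 ▸ hmem)
    · exact ha.2 (h.1 ▸ hmem)
  have hproper : IsProperEdgeColoring (σ.forest (t + 1)) (Function.update col s(u, v) a) := by
    intro x y z hy hz hyz
    rcases hins.adj_or x y hy with hy' | hy' <;> rcases hins.adj_or x z hz with hz' | hz'
    · rw [hold s(x, y) hy', hold s(x, z) hz']
      exact hcol x y z hy' hz' hyz
    · rw [hold s(x, y) hy', hz', Function.update_self]
      exact hends x z hz' y hy'
    · rw [hold s(x, z) hz', hy', Function.update_self]
      exact (hends x y hy' z hz').symm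
    · rw [← hz', Sym2.congr_right] at hy'
      exact absurd hy' hyz
  have hzero : recourse (σ.forest t) col (Function.update col s(u, v) a) = 0 := by
    rw [recourse, Set.ncard_eq_zero (Set.toFinite _), Set.eq_empty_iff_forall_notMem]
    exact fun e he => he.2 (hold e he.1)
  have := hgreedy.2 _ hproper
  lia

theorem card_mul_le [Fintype V] {c : ℕ} (H : Finset (Fin σ.length))
    (hH : ∀ i ∈ H, ∀ u v, σ.edge i = s(u, v) → Δ + c ≤ σ.degreeAt i u + σ.degreeAt i v) :
    H.card * (c + Nat.sqrt Δ) ≤ 10 * σ.length := by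
  classical
  obtain ⟨f, hf, hinj⟩ := exists_injOn_endpoint (σ.isAcyclic σ.length le_rfl)
  have hedge : ∀ i, σ.edge i ∈ (σ.forest σ.length).edgeSet := fun i => by
    have h : ∀ e, σ.edge i = e → e ∈ (σ.forest σ.length).edgeSet := by
      intro e
      induction e using Sym2.ind with
      | _ x y => exact fun h => σ.forest_adj.2 ⟨i, i.2, h⟩
    exact h _ rfl
  set child : Fin σ.length → V := fun i => f (σ.edge i) with hchild
  have hchild_inj : Function.Injective child := fun i j hij =>
    σ.injective (hinj (hedge i) (hedge j) hij)
  have hpar : ∀ i, ∃ y, σ.edge i = s(child i, y) := fun i => hf _ (hedge i)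
  choose par hpar using hpar
  set D : V → ℕ := σ.degreeAt σ.length with hD
  set s := Nat.sqrt Δ with hs
  have hsum : ∀ S : Finset (Fin σ.length), ∑ i ∈ S, D (child i) ≤ 2 * σ.length := fun S => by
    rw [← Finset.sum_image (f := D) hchild_inj.injOn]
    exact (Finset.sum_le_univ_sum_of_nonneg fun _ => Nat.zero_le _).trans (σ.sum_degreeAt_le _)
  have hDle : ∀ (i : Fin σ.length) v, σ.degreeAt i v ≤ D v := fun i v =>
    σ.degreeAt_mono i.2.le v
  -- The number of edges of `H` that the parent receives from time `i` on. At time `i` its degree is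
  -- at most `Δ - rank i`, so the child has degree at least `c + rank i`.
  set rank : Fin σ.length → ℕ := fun i => (H.filter fun j => par j = par i ∧ i ≤ j).card with hrank
  have hrank_le : ∀ i ∈ H, c + rank i ≤ D (child i) := by
    intro i hi
    have h1 : σ.degreeAt i (par i) + rank i ≤ D (par i) := by
      rw [hrank, hD, degreeAt, degreeAt, ← Finset.card_union_of_disjoint]
      · refine Finset.card_le_card fun j hj => ?_
        simp only [Finset.mem_union, Finset.mem_filter, Finset.mem_univ, true_and] at hj ⊢
        refine ⟨j.2, ?_⟩
        rcases hj with hj | hj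
        · exact hj.2
        · rw [hpar j, ← hj.2.1]
          simp
      · refine Finset.disjoint_left.2 fun j hj hj' => ?_
        simp only [Finset.mem_filter, Finset.mem_univ, true_and] at hj hj'
        exact absurd hj.1 (not_lt.2 hj'.2.2)
    have h2 := hH i hi _ _ (hpar i)
    have h3 : D (par i) ≤ Δ := σ.degreeAt_le le_rfl _
    have h4 := hDle i (child i)
    lia
  have hc : H.card * c ≤ 2 * σ.length := by
    refine le_trans ?_ (hsum H)
    rw [← smul_eq_mul]
    exact Finset.card_nsmul_le_sum _ _ _ fun i hi => (Nat.le_add_right _ _).trans (hrank_le i hi)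
  -- Edges with a child of degree at least s/2 are counted by child degrees. The others have a
  -- parent of degree at least s²/2, and are counted by parent degrees.
  set H₁ := H.filter fun i => s ≤ 2 * D (child i) with hH₁
  set H₂ := H.filter fun i => ¬ s ≤ 2 * D (child i) with hH₂
  have hcard : H.card = H₁.card + H₂.card := (Finset.card_filter_add_card_filter_not _).symm
  have h₁ : H₁.card * s ≤ 4 * σ.length := by
    have : H₁.card * s ≤ ∑ i ∈ H₁, 2 * D (child i) := by
      rw [← smul_eq_mul]
      exact Finset.card_nsmul_le_sum _ _ _ fun i hi => (Finset.mem_filter.1 hi).2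
    rw [← Finset.mul_sum] at this
    have := hsum H₁
    lia
  have hsΔ : s * s ≤ Δ := Nat.sqrt_le Δ
  have hpar₂ : ∀ p ∈ H₂.image par, s * s ≤ 2 * D p := by
    intro p hp
    obtain ⟨i, hi, rfl⟩ := Finset.mem_image.1 hp
    obtain ⟨hiH, his⟩ := Finset.mem_filter.1 hi
    have h2 := hH i hiH _ _ (hpar i)
    have h4 := hDle i (child i)
    have h5 := hDle i (par i)
    have h6 := Nat.le_mul_self s
    lia
  have hfib : ∀ p ∈ H₂.image par, (H₂.filter fun i => par i = p).card ≤ s := by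
    intro p hp
    obtain ⟨j, hj, hjp⟩ := Finset.mem_image.1 hp
    have hne : (H₂.filter fun i => par i = p).Nonempty := ⟨j, Finset.mem_filter.2 ⟨hj, hjp⟩⟩
    -- The earliest edge of the fiber has rank at least the fiber's size, but its child has degree
    -- below s/2.
    obtain ⟨i, hi, hmin⟩ := Finset.exists_min_image _ id hne
    obtain ⟨hi₂, hip⟩ := Finset.mem_filter.1 hi
    obtain ⟨hiH, his⟩ := Finset.mem_filter.1 hi₂
    have h1 : (H₂.filter fun i => par i = p).card ≤ rank i := by
      refine Finset.card_le_card fun l hl => ?_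
      obtain ⟨hl₂, hlp⟩ := Finset.mem_filter.1 hl
      exact Finset.mem_filter.2
        ⟨(Finset.mem_filter.1 hl₂).1, hlp.trans hip.symm, hmin l hl⟩
    have h2 := hrank_le i hiH
    lia
  have h₂ : H₂.card * s ≤ 4 * σ.length := by
    calc H₂.card * s = ∑ p ∈ H₂.image par, (H₂.filter fun i => par i = p).card * s := by
          rw [← Finset.sum_mul, ← Finset.card_eq_sum_card_image]
      _ ≤ ∑ p ∈ H₂.image par, 2 * D p := Finset.sum_le_sum fun p hp =>
          (Nat.mul_le_mul_right s (hfib p hp)).trans (hpar₂ p hp)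
      _ ≤ ∑ p, 2 * D p := Finset.sum_le_univ_sum_of_nonneg fun _ => Nat.zero_le _
      _ = 2 * ∑ p, D p := by rw [Finset.mul_sum]
      _ ≤ 2 * (2 * σ.length) := Nat.mul_le_mul_left _ (σ.sum_degreeAt_le _)
      _ = _ := by ring
  rw [mul_add]
  have : H.card * s = H₁.card * s + H₂.card * s := by rw [hcard, add_mul]
  lia

/-- Vertices that stay isolated gain nothing; every other vertex gains at most 1/√κ, and there are
at most 2T of them. -/
theorem sum_potential_sub_le [Fintype V] (hκ : 0 < κ) :
    ∑ x, potential κ (componentSize (σ.forest σ.length) x) -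
      ∑ x, potential κ (componentSize (σ.forest 0) x) ≤ 2 * σ.length / √κ := by
  classical
  have hκ0 : 0 < √(κ : ℝ) := Real.sqrt_pos.2 (by exact_mod_cast hκ)
  have hpt : ∀ x, potential κ (componentSize (σ.forest σ.length) x) -
      potential κ (componentSize (σ.forest 0) x) ≤ σ.degreeAt σ.length x / √κ := by
    intro x
    rcases Nat.eq_zero_or_pos (σ.degreeAt σ.length x) with h0 | hpos
    · have hsize : componentSize (σ.forest σ.length) x ≤ 1 := by
        rw [componentSize, ← Set.ncard_singleton x]
        refine Set.ncard_le_ncard ?_ (Set.toFinite _)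
        rintro y ⟨P⟩
        cases P with
        | nil => rfl
        | cons hadj _ =>
          obtain ⟨i, _, he⟩ := σ.forest_adj.1 hadj
          rw [degreeAt, Finset.card_eq_zero, Finset.filter_eq_empty_iff] at h0
          exact absurd ⟨i.2, by rw [he]; simp⟩ (h0 (Finset.mem_univ i))
      rw [h0, Nat.cast_zero, zero_div, sub_nonpos]
      exact potential_mono hκ (hsize.trans (componentSize_pos _ _))
    · have h1 : potential κ (componentSize (σ.forest σ.length) x) ≤ 0 :=
        neg_nonpos.2 (by positivity)
      have h2 : -potential κ (componentSize (σ.forest 0) x) ≤ 1 / √κ := by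
        rw [potential, neg_neg]
        have := Real.sqrt_le_sqrt (le_max_right (4 * (componentSize (σ.forest 0) x : ℝ)) κ)
        gcongr
      have h3 : 1 / √(κ : ℝ) ≤ σ.degreeAt σ.length x / √κ := by
        gcongr
        exact_mod_cast hpos
      linarith
  rw [← Finset.sum_sub_distrib]
  refine (Finset.sum_le_sum fun x _ => hpt x).trans ?_
  rw [← Finset.sum_div]
  gcongr
  exact_mod_cast σ.sum_degreeAt_le _

end InsertionSequence

/-! ### Amortization over the whole sequence -/

theorem IsGreedyExecution.isProperEdgeColoring {V : Type*} {Δ κ : ℕ} {σ : InsertionSequence V Δ}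
    {col : ℕ → Sym2 V → Fin κ} (h : IsGreedyExecution σ col) {t : ℕ} (ht : t ≤ σ.length) :
    IsProperEdgeColoring (σ.forest t) (col t) := by
  cases t with
  | zero =>
    intro u v w huv
    obtain ⟨i, hi, _⟩ := σ.forest_adj.1 huv
    exact absurd hi (Nat.not_lt_zero _)
  | succ t => exact (h t ht).1

theorem IsGreedyExecution.sum_recourse_le {V : Type*} [Fintype V] {Δ c κ : ℕ}
    (hΔ : 3 ≤ Δ) (hκ : κ = Δ + c) {σ : InsertionSequence V Δ} {col : ℕ → Sym2 V → Fin κ} (h : IsGreedyExecution σ col) :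
    (∑ t ∈ Finset.range σ.length, (recourse (σ.forest t) (col t) (col (t + 1)) : ℝ)) *
      (c + √Δ) ≤ 136 * σ.length := by
  classical
  set Ψ : ℕ → ℝ := fun t => ∑ x, potential κ (componentSize (σ.forest t) x) with hΨ
  set r : ℕ → ℕ := fun t => recourse (σ.forest t) (col t) (col (t + 1)) with hr
  set H : Finset (Fin σ.length) := Finset.univ.filter fun i => 1 ≤ r i with hH
  have hκpos : (0 : ℝ) < κ := by exact_mod_cast (by lia : 0 < κ)
  have hκ0 : 0 < √(κ : ℝ) := Real.sqrt_pos.2 hκpos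
  have hstep : ∀ i : Fin σ.length,
      (r i : ℝ) ≤ 2 * (if 1 ≤ r i then 1 else 0) + 48 / √κ * (Ψ (i + 1) - Ψ i) := by
    intro i
    have hmono : 0 ≤ 48 / √(κ : ℝ) * (Ψ (i + 1) - Ψ i) :=
      mul_nonneg (by positivity)
        (sub_nonneg.2 (sum_potential_mono (by lia) (σ.forest_mono (Nat.le_succ _))))
    rcases lt_or_ge (r i) 3 with hlt | hge
    · split_ifs with h1
      · have : (r i : ℝ) ≤ 2 := by exact_mod_cast Nat.lt_succ_iff.1 hlt
        linarith
      · have : (r i : ℝ) = 0 := by exact_mod_cast Nat.lt_one_iff.1 (not_le.1 h1)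
        linarith
    · obtain ⟨u, v, huv⟩ : ∃ u v, σ.edge i = s(u, v) := by
        induction σ.edge i using Sym2.ind with
        | _ u v => exact ⟨u, v, rfl⟩
      -- Before the insertion both endpoints have degree below `Δ`, hence a free color.
      have hmiss : ∀ w ∈ σ.edge i, ∃ a, ∀ y, (σ.forest i).Adj w y → col i s(w, y) ≠ a := by
        intro w hw
        have h1 := σ.degreeAt_succ_le hw
        have h2 := σ.degreeAt_le (t := i + 1) i.2 w
        exact σ.exists_missing _ (by lia)
      have := (h i i.2).recourse_le (by lia) (G' := σ.forest (i + 1)) (σ.isAcyclic (i + 1) i.2)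
        (σ.isInsertion huv)
        (h.isProperEdgeColoring i.2.le) (hmiss u (by rw [huv]; simp))
        (hmiss v (by rw [huv]; simp)) hge
      have h0 : (0 : ℝ) ≤ if 1 ≤ r i then 1 else 0 := by split_ifs <;> norm_num
      linarith
  have hcount := σ.card_mul_le (c := c) H fun i hi u v huv =>
    hκ ▸ σ.le_degreeAt_add_of_recourse_pos huv (h.isProperEdgeColoring i.2.le) (h i i.2)
      (Finset.mem_filter.1 hi).2
  have htotal : ∑ t ∈ Finset.range σ.length, (r t : ℝ) ≤
      2 * H.card + 48 / √κ * (2 * σ.length / √κ) := by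
    calc ∑ t ∈ Finset.range σ.length, (r t : ℝ) = ∑ i : Fin σ.length, (r i : ℝ) :=
          Finset.sum_range _
      _ ≤ ∑ i : Fin σ.length,
          (2 * (if 1 ≤ r i then 1 else 0) + 48 / √κ * (Ψ (i + 1) - Ψ i)) :=
          Finset.sum_le_sum fun i _ => hstep i
      _ = 2 * H.card + 48 / √κ * (Ψ σ.length - Ψ 0) := by
          rw [Finset.sum_add_distrib, ← Finset.mul_sum, ← Finset.mul_sum, ← Finset.sum_range_sub,
            Finset.sum_range fun t => Ψ (t + 1) - Ψ t, Finset.sum_boole]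
      _ ≤ _ := by
          gcongr
          exact σ.sum_potential_sub_le (by lia)
  have hsqrt : √(Δ : ℝ) ≤ 2 * Nat.sqrt Δ := by
    have h1 : √(Δ : ℝ) ≤ Nat.sqrt Δ + 1 := Real.real_sqrt_le_nat_sqrt_succ
    have h2 : (1 : ℝ) ≤ Nat.sqrt Δ := by
      exact_mod_cast Nat.sqrt_pos.2 (by lia)
    linarith
  have hcount' : (H.card : ℝ) * (c + √Δ) ≤ 20 * σ.length := by
    have h1 : (H.card : ℝ) * (c + Nat.sqrt Δ) ≤ 10 * σ.length := by exact_mod_cast hcount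
    have h2 : (H.card : ℝ) * (c + √Δ) ≤ H.card * (2 * (c + Nat.sqrt Δ)) := by
      gcongr
      have : (0 : ℝ) ≤ c := Nat.cast_nonneg c
      linarith
    linarith
  have hL : (c : ℝ) + √Δ ≤ κ := by
    have h1 : √(Δ : ℝ) ≤ Δ := by
      rw [Real.sqrt_le_left (by positivity)]
      have : (1 : ℝ) ≤ Δ := by exact_mod_cast (by lia : 1 ≤ Δ)
      nlinarith
    rw [hκ]
    push_cast
    linarith
  have hpot : 48 / √(κ : ℝ) * (2 * σ.length / √κ) = 96 * σ.length / κ := by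
    rw [div_mul_div_comm, Real.mul_self_sqrt hκpos.le]
    ring
  rw [hpot] at htotal
  have hfin : 96 * (σ.length : ℝ) / κ * (c + √Δ) ≤ 96 * σ.length := by
    rw [div_mul_eq_mul_div, div_le_iff₀ hκpos]
    gcongr
  have hL0 : (0 : ℝ) ≤ c + √Δ := by positivity
  -- The constant is 136 = 2 · 20 + 96: recourse at most two on each edge of `H`, plus the share
  -- paid by the potential.
  calc _ ≤ (2 * H.card + 96 * σ.length / κ) * (c + √Δ) := by gcongr
    _ = 2 * (H.card * (c + √Δ)) + 96 * σ.length / κ * (c + √Δ) := by ring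
    _ ≤ 2 * (20 * σ.length) + 96 * σ.length := by gcongr
    _ = _ := by ring

end IncrementalForest

theorem mainTheorem1 :
    ∃ C : ℝ, 0 < C ∧
      ∀ (Δ c : ℕ), 3 ≤ Δ →
        ∀ (V : Type*) [Finite V] (σ : IncrementalForest.InsertionSequence V Δ)
          (col : ℕ → Sym2 V → Fin (Δ + c)),
          IncrementalForest.IsGreedyExecution σ col →
            IncrementalForest.amortizedRecourse σ col ≤ C / ((c : ℝ) + Real.sqrt (Δ : ℝ)) := by
  refine ⟨136, by norm_num, fun Δ c hΔ V _ σ col h => ?_⟩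
  cases nonempty_fintype V
  have hΔ0 : (0 : ℝ) < Δ := by exact_mod_cast (by lia : 0 < Δ)
  have hL : (0 : ℝ) < c + √Δ := by positivity
  rw [IncrementalForest.amortizedRecourse, le_div_iff₀ hL, div_mul_eq_mul_div]
  exact div_le_of_le_mul₀ (Nat.cast_nonneg _) (by norm_num) (h.sum_recourse_le hΔ rfl)
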